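/- Theorem 1. Fix a many-sorted nominal signature: types are name types $\nu$, data types $\delta$ and abstraction types $\langle\nu\rangle\tau$; every name type has infinitely many names; function symbols $f$ and predicate symbols $p$ have fixed argument types, and no function symbol has a name type as its result type. Syntax (all expressions well-typed). Terms are $t,u ::= a \mid X \mid f(\vec t) \mid (a\ b)\cdot t \mid \langle a\rangle t$ with $a,b$ names ($a$ and $b$ of the same name type in $(a\ b)$). Goals are $G ::= \top \mid p(\vec t) \mid a\# t \mid t\approx u \mid G\wedge G' \mid G\vee G' \mid \exists X.G \mid \mathsf{И}a.G$, and program clauses are $\mathsf{И}\vec a.\forall\vec X.[p(\vec t) :\!- G]$ without free variables or free names. The quantifiers $\forall,\exists,\mathsf{И}$ are binders, expressions are identified up to renaming of what they bind, and substitution avoids capture by them; $\langle a\rangle$ is not a binder. An expression is ground if it has no free variables (it may contain free names). Ground terms. Swapping is computed by exchanging $a$ and $b$ throughout: $(a\ b)\cdot a=b$, $(a\ b)\cdot b=a$, $(a\ b)\cdot a'=a'$ for $a'\neq a,b$, $(a\ b)\cdot f(\vec t)=f(\overrightarrow{(a\ b)\cdot t})$, $(a\ b)\cdot\langle a'\rangle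 t=\langle (a\ b)\cdot a'\rangle (a\ b)\cdot t$. Freshness is generated by: $\models a\# b$ if $a\neq b$; $\models a\# f(\vec t)$ if $\models a\# t_i$ for all $i$; $\models a\#\langle a\rangle t$; $\models a\#\langle b\rangle t$ if $\models a\# b$ and $\models a\# t$. Equality is generated by: $\models a\approx a$; $\models f(\vec t)\approx f(\vec u)$ if $\models t_i\approx u_i$ for all $i$; $\models\langle a\rangle t\approx\langle a\rangle u$ if $\models t\approx u$; $\models\langle a\rangle t\approx\langle b\rangle u$ if $\models a\# u$ and $\models t\approx(a\ b)\cdot u$. A permutation $\pi$ is a composition of zero or more swappings, and $\pi.e$ is its effect on the names free in $e$. Proofs. For a set $\Delta$ of program clauses and a ground goal $G$, provability of the sequent $\Delta\Longrightarrow G$ is generated by the rules: $\Delta\Longrightarrow\top$; $\Delta\Longrightarrow a\# t$ if $\models a\# t$; $\Delta\Longrightarrow t\approx u$ if $\models t\approx u$; $\Delta\Longrightarrow G_1\wedge G_2$ from $\Delta\Longrightarrow G_1$ and $\Delta\Longrightarrow G_2$; $\Delta\Longrightarrow G_1\vee G_2$ from $\Delta\Longrightarrow G_i$ for $i=1$ or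 $i=2$; $\Delta\Longrightarrow\exists X.G$ from $\Delta\Longrightarrow G[t/X]$ for a ground term $t$; $\Delta\Longrightarrow\mathsf{И}a.G$ from $\Delta\Longrightarrow G$; and $\Delta\Longrightarrow p(\vec t)$ from $\Delta\Longrightarrow\pi.(G\theta)$ whenever $\mathsf{И}\vec a.\forall\vec X.[p(\vec u):\!-G]\in\Delta$ (with $\vec a$ distinct), $\pi$ is a permutation and $\theta$ is a substitution of ground terms for $\vec X$ (which may contain any names) such that $\models t_i\approx(\pi.(\vec u\theta))_i$ for all $i$. Semantics. A Herbrand interpretation $H$ is a set of ground atoms $p(\vec t)$ that is closed under swappings of names and under replacing arguments by $\approx$-equal ones. Satisfaction $H\models\varphi$ of formulas of nominal logic without free variables is defined by: $H\models p(\vec t)$ iff $p(\vec t)\in H$; $H\models a\# t$ iff $\models a\# t$; $H\models t\approx u$ iff $\models t\approx u$; the usual clauses for $\top,\wedge,\vee,\supset$; $\forall X$ and $\exists X$ range over the ground terms of the type of $X$; and $H\models\mathsf{И}a.\varphi$ iff $H\models\varphi$ with $a$ instantiated by a fresh name. A clause $\mathsf{И}\vec a.\forall\vec X.[p(\vec t):\!-G]$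 is read as the formula $\mathsf{И}\vec a.\forall\vec X.(G\supset p(\vec t))$. $\Delta\models G$ means that every Herbrand interpretation satisfying all clauses in $\Delta$ satisfies $G$. Claim: for every set $\Delta$ of program clauses and every ground goal $G$, $\Delta\models G$ holds if and only if $\Delta\Longrightarrow G$ has a proof. -/

import Mathlib

universe u

namespace AlphaProlog

/-! ## Types and signatures -/

/-- Monomorphic types: name types, data types, and types of name-abstractions. -/
inductive Ty (N D : Type u) : Type u
  | name (ν : N) : Ty N D
  | data (δ : D) : Ty N D
  | abs (ν : N) (τ : Ty N D) : Ty N D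

/-- A many-sorted nominal signature. There are infinitely many names of each name type, and no
function symbol produces an element of a name type. Constants are function symbols with an empty
list of argument types. -/
structure Signature where
  /-- name types -/
  NTy : Type u
  /-- data types -/
  DTy : Type u
  /-- names -/
  Name : Type u
  /-- the name type of a name -/
  nty : Name → NTy
  infinite_names : ∀ ν : NTy, {a : Name | nty a = ν}.Infinite
  /-- function symbols -/
  Fn : Type u
  dom : Fn → List (Ty NTy DTy)
  cod : Fn → Ty NTy DTy
  cod_ne_name : ∀ (f : Fn) (ν : NTy), cod f ≠ Ty.name ν
  /-- predicate symbols -/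
  Pr : Type u
  pdom : Pr → List (Ty NTy DTy)

/-- The types over a signature. -/
abbrev Signature.Typ (S : Signature.{u}) : Type u := Ty S.NTy S.DTy

/-! ## Swappings -/

/-- A swapping `(a b)` of two names of the same name type. -/
structure Swapping (S : Signature.{u}) where
  fst : S.Name
  snd : S.Name
  same : S.nty fst = S.nty snd

/-- The action of a swapping on names. -/
noncomputable def Swapping.onName {S : Signature.{u}} (s : Swapping S) (c : S.Name) : S.Name :=
  @Equiv.swap S.Name (Classical.decEq S.Name) s.fst s.snd c

theorem Swapping.nty_onName {S : Signature.{u}} (s : Swapping S) (c : S.Name) :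
    S.nty (s.onName c) = S.nty c := by
  unfold Swapping.onName
  rw [@Equiv.swap_apply_def S.Name (Classical.decEq S.Name)]
  split_ifs with h1 h2
  · rw [h1, s.same]
  · rw [h2, s.same]
  · rfl

/-- A permutation is a composition of zero or more swappings (the head is applied last). -/
abbrev Permutation (S : Signature.{u}) : Type u := List (Swapping S)

/-! ## Ground nominal terms: swapping, freshness and equality -/

/-- Ground nominal terms, in which all swappings have been carried out. Note that `abs a t` is
name-abstraction `⟨a⟩t`, which is not a binder: the name `a` occurs in it. -/
inductive GTerm (S : Signature.{u}) : S.Typ → Type u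
  | name {ν : S.NTy} (a : S.Name) (h : S.nty a = ν) : GTerm S (Ty.name ν)
  | app {τ : S.Typ} (f : S.Fn) (h : S.cod f = τ)
      (ts : ∀ i : Fin (S.dom f).length, GTerm S ((S.dom f).get i)) : GTerm S τ
  | abs {ν : S.NTy} {τ : S.Typ} (a : S.Name) (h : S.nty a = ν) (t : GTerm S τ) :
      GTerm S (Ty.abs ν τ)

/-- Swapping `(a b)·t` on ground terms. -/
noncomputable def GTerm.swap {S : Signature.{u}} (s : Swapping S) :
    {τ : S.Typ} → GTerm S τ → GTerm S τ
  | _, .name a h => .name (s.onName a) ((s.nty_onName a).trans h)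
  | _, .app f h ts => .app f h (fun i => (ts i).swap s)
  | _, .abs a h t => .abs (s.onName a) ((s.nty_onName a).trans h) (t.swap s)

/-- The judgment `⊨ a # t`. -/
inductive Fresh {S : Signature.{u}} (a : S.Name) : {τ : S.Typ} → GTerm S τ → Prop
  | name {ν : S.NTy} (b : S.Name) (h : S.nty b = ν) : a ≠ b → Fresh a (GTerm.name b h)
  | app {τ : S.Typ} (f : S.Fn) (h : S.cod f = τ)
      (ts : ∀ i : Fin (S.dom f).length, GTerm S ((S.dom f).get i)) :
      (∀ i, Fresh a (ts i)) → Fresh a (GTerm.app f h ts)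
  | abs_same {ν : S.NTy} {τ : S.Typ} (h : S.nty a = ν) (t : GTerm S τ) :
      Fresh a (GTerm.abs a h t)
  | abs_other {ν : S.NTy} {τ : S.Typ} (b : S.Name) (h : S.nty b = ν) (t : GTerm S τ) :
      a ≠ b → Fresh a t → Fresh a (GTerm.abs b h t)

/-- The judgment `⊨ t ≈ u`. -/
inductive Equal {S : Signature.{u}} : {τ : S.Typ} → GTerm S τ → GTerm S τ → Prop
  | name {ν : S.NTy} (a : S.Name) (h : S.nty a = ν) : Equal (GTerm.name a h) (GTerm.name a h)
  | app {τ : S.Typ} (f : S.Fn) (h : S.cod f = τ)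
      (ts us : ∀ i : Fin (S.dom f).length, GTerm S ((S.dom f).get i)) :
      (∀ i, Equal (ts i) (us i)) → Equal (GTerm.app f h ts) (GTerm.app f h us)
  | abs_same {ν : S.NTy} {τ : S.Typ} (a : S.Name) (h : S.nty a = ν) (t u : GTerm S τ) :
      Equal t u → Equal (GTerm.abs a h t) (GTerm.abs a h u)
  | abs_other {ν : S.NTy} {τ : S.Typ} (a b : S.Name) (ha : S.nty a = ν) (hb : S.nty b = ν)
      (t u : GTerm S τ) :
      Fresh a u → Equal t (u.swap ⟨a, b, ha.trans hb.symm⟩) →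
      Equal (GTerm.abs a ha t) (GTerm.abs b hb u)

/-! ## Terms with variables

Bound variables and bound names are represented by typed de Bruijn indices, so that expressions
are identified up to renaming of what the quantifiers `∀ ∃ И` bind, and substitution avoids
capture. Names that no `И` binds are actual names of the signature. -/

/-- Typed de Bruijn indices. -/
inductive Idx {α : Type u} : List α → α → Type u
  | zero {x : α} {l : List α} : Idx (x :: l) x
  | succ {x y : α} {l : List α} (i : Idx l x) : Idx (y :: l) x

/-- A name occurrence of name type `ν`: a free name, or one bound by an enclosing `И`. -/
inductive NRef (S : Signature.{u}) (Ξ : List S.NTy) (ν : S.NTy) : Type u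
  | free (a : S.Name) (h : S.nty a = ν) : NRef S Ξ ν
  | bound (i : Idx Ξ ν) : NRef S Ξ ν

/-- Terms `a | X | f(t₁,…,tₙ) | (a b)·t | ⟨a⟩t`, with bound names typed by `Ξ` and
variables typed by `Γ`. -/
inductive Tm (S : Signature.{u}) (Ξ : List S.NTy) (Γ : List S.Typ) : S.Typ → Type u
  | name {ν : S.NTy} (n : NRef S Ξ ν) : Tm S Ξ Γ (Ty.name ν)
  | var {τ : S.Typ} (x : Idx Γ τ) : Tm S Ξ Γ τ
  | app {τ : S.Typ} (f : S.Fn) (h : S.cod f = τ)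
      (ts : ∀ i : Fin (S.dom f).length, Tm S Ξ Γ ((S.dom f).get i)) : Tm S Ξ Γ τ
  | swap {ν : S.NTy} {τ : S.Typ} (m n : NRef S Ξ ν) (t : Tm S Ξ Γ τ) : Tm S Ξ Γ τ
  | abs {ν : S.NTy} {τ : S.Typ} (n : NRef S Ξ ν) (t : Tm S Ξ Γ τ) : Tm S Ξ Γ (Ty.abs ν τ)

/-- Ground terms: no variables; free names are allowed. -/
abbrev Ground (S : Signature.{u}) (τ : S.Typ) : Type u := Tm S [] [] τ

/-- The name denoted by an occurrence that is not bound. -/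
def NRef.atom {S : Signature.{u}} {ν : S.NTy} : NRef S [] ν → S.Name
  | .free a _ => a

theorem NRef.nty_atom {S : Signature.{u}} {ν : S.NTy} : (n : NRef S [] ν) → S.nty n.atom = ν
  | .free _ h => h

/-- The ground nominal term denoted by a ground term: all swappings are carried out. -/
noncomputable def Tm.eval {S : Signature.{u}} : {τ : S.Typ} → Ground S τ → GTerm S τ
  | _, .name n => .name n.atom n.nty_atom
  | _, .var x => nomatch x
  | _, .app f h ts => .app f h (fun i => (ts i).eval)
  | _, .swap m n t => t.eval.swap ⟨m.atom, n.atom, m.nty_atom.trans n.nty_atom.symm⟩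
  | _, .abs n t => .abs n.atom n.nty_atom t.eval

/-- The free names that occur in a name occurrence. -/
def NRef.names {S : Signature.{u}} {Ξ : List S.NTy} {ν : S.NTy} : NRef S Ξ ν → Set S.Name
  | .free a _ => {a}
  | .bound _ => ∅

/-- The free names that occur in a term. -/
def Tm.names {S : Signature.{u}} {Ξ : List S.NTy} {Γ : List S.Typ} :
    {τ : S.Typ} → Tm S Ξ Γ τ → Set S.Name
  | _, .name n => n.names
  | _, .var _ => ∅
  | _, .app _ _ ts => ⋃ i, (ts i).names
  | _, .swap m n t => m.names ∪ n.names ∪ t.names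
  | _, .abs n t => n.names ∪ t.names

/-- A map of name occurrences. -/
abbrev NMap (S : Signature.{u}) (Ξ Ξ' : List S.NTy) : Type u :=
  ∀ ν : S.NTy, NRef S Ξ ν → NRef S Ξ' ν

/-- Weakening by one more bound name. -/
def NMap.weaken {S : Signature.{u}} {Ξ : List S.NTy} (μ : S.NTy) : NMap S Ξ (μ :: Ξ)
  | _, .free a h => .free a h
  | _, .bound i => .bound i.succ

/-- Passing under a binder `И`. -/
def NMap.lift {S : Signature.{u}} {Ξ Ξ' : List S.NTy} (r : NMap S Ξ Ξ') (μ : S.NTy) :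
    NMap S (μ :: Ξ) (μ :: Ξ')
  | _, .free a h => NMap.weaken μ _ (r _ (.free a h))
  | _, .bound .zero => .bound .zero
  | _, .bound (.succ i) => NMap.weaken μ _ (r _ (.bound i))

/-- Replacing the innermost bound name by the name `b`. -/
def NMap.inst {S : Signature.{u}} {Ξ : List S.NTy} {μ : S.NTy} (b : S.Name)
    (hb : S.nty b = μ) : NMap S (μ :: Ξ) Ξ
  | _, .free a h => .free a h
  | _, .bound .zero => .free b hb
  | _, .bound (.succ i) => .bound i

/-- Replacing all bound names by names. -/
def NMap.instAll {S : Signature.{u}} {Ξ : List S.NTy}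
    (ρ : ∀ ν : S.NTy, Idx Ξ ν → S.Name) (hρ : ∀ ν i, S.nty (ρ ν i) = ν) : NMap S Ξ []
  | _, .free a h => .free a h
  | _, .bound i => .free (ρ _ i) (hρ _ i)

/-- The action of a swapping on the free names. -/
noncomputable def NMap.swap {S : Signature.{u}} {Ξ : List S.NTy} (s : Swapping S) : NMap S Ξ Ξ
  | _, .free a h => .free (s.onName a) ((s.nty_onName a).trans h)
  | _, .bound i => .bound i

/-- Applying a map of name occurrences to a term. -/
def Tm.ren {S : Signature.{u}} {Ξ Ξ' : List S.NTy} {Γ : List S.Typ} (r : NMap S Ξ Ξ') :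
    {τ : S.Typ} → Tm S Ξ Γ τ → Tm S Ξ' Γ τ
  | _, .name n => .name (r _ n)
  | _, .var x => .var x
  | _, .app f h ts => .app f h (fun i => (ts i).ren r)
  | _, .swap m n t => .swap (r _ m) (r _ n) (t.ren r)
  | _, .abs n t => .abs (r _ n) (t.ren r)

/-- The effect `π.t` of a permutation on a term; variables are left alone. -/
noncomputable def Tm.perm {S : Signature.{u}} {Ξ : List S.NTy} {Γ : List S.Typ} {τ : S.Typ}
    (π : Permutation S) (t : Tm S Ξ Γ τ) : Tm S Ξ Γ τ :=
  π.foldr (fun s t => t.ren (NMap.swap s)) t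

/-- Simultaneous substitutions of terms for variables. -/
abbrev Sub (S : Signature.{u}) (Ξ : List S.NTy) (Γ Γ' : List S.Typ) : Type u :=
  ∀ τ : S.Typ, Idx Γ τ → Tm S Ξ Γ' τ

/-- Applying a substitution to a term. Name-abstraction is not a binder, so names may be
captured by it. -/
def Tm.subst {S : Signature.{u}} {Ξ : List S.NTy} {Γ Γ' : List S.Typ} (σ : Sub S Ξ Γ Γ') :
    {τ : S.Typ} → Tm S Ξ Γ τ → Tm S Ξ Γ' τ
  | _, .name n => .name n
  | _, .var x => σ _ x
  | _, .app f h ts => .app f h (fun i => (ts i).subst σ)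
  | _, .swap m n t => .swap m n (t.subst σ)
  | _, .abs n t => .abs n (t.subst σ)

/-- Passing a substitution under a variable binder. -/
def Sub.lift {S : Signature.{u}} {Ξ : List S.NTy} {Γ Γ' : List S.Typ} (σ : Sub S Ξ Γ Γ')
    (κ : S.Typ) : Sub S Ξ (κ :: Γ) (κ :: Γ')
  | _, .zero => .var .zero
  | _, .succ x => (σ _ x).subst (fun _ y => .var y.succ)

/-- Passing a substitution under a name binder. -/
def Sub.weakenName {S : Signature.{u}} {Ξ : List S.NTy} {Γ Γ' : List S.Typ} (σ : Sub S Ξ Γ Γ')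
    (μ : S.NTy) : Sub S (μ :: Ξ) Γ Γ' :=
  fun τ x => (σ τ x).ren (NMap.weaken μ)

/-- The substitution `[t/X]` for the innermost bound variable. -/
def Sub.inst {S : Signature.{u}} {Ξ : List S.NTy} {Γ : List S.Typ} {κ : S.Typ}
    (t : Tm S Ξ Γ κ) : Sub S Ξ (κ :: Γ) Γ
  | _, .zero => t
  | _, .succ x => .var x

/-! ## Formulas of nominal logic, goals, program clauses -/

/-- Formulas of nominal logic. -/
inductive Formula (S : Signature.{u}) : List S.NTy → List S.Typ → Type u
  | top {Ξ : List S.NTy} {Γ : List S.Typ} : Formula S Ξ Γ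
  | bot {Ξ : List S.NTy} {Γ : List S.Typ} : Formula S Ξ Γ
  | pred {Ξ : List S.NTy} {Γ : List S.Typ} (p : S.Pr)
      (ts : ∀ i : Fin (S.pdom p).length, Tm S Ξ Γ ((S.pdom p).get i)) : Formula S Ξ Γ
  | fresh {Ξ : List S.NTy} {Γ : List S.Typ} {ν : S.NTy} {τ : S.Typ} (n : NRef S Ξ ν)
      (t : Tm S Ξ Γ τ) : Formula S Ξ Γ
  | eq {Ξ : List S.NTy} {Γ : List S.Typ} {τ : S.Typ} (t v : Tm S Ξ Γ τ) : Formula S Ξ Γ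
  | and {Ξ : List S.NTy} {Γ : List S.Typ} (φ ψ : Formula S Ξ Γ) : Formula S Ξ Γ
  | or {Ξ : List S.NTy} {Γ : List S.Typ} (φ ψ : Formula S Ξ Γ) : Formula S Ξ Γ
  | imp {Ξ : List S.NTy} {Γ : List S.Typ} (φ ψ : Formula S Ξ Γ) : Formula S Ξ Γ
  | ex {Ξ : List S.NTy} {Γ : List S.Typ} (τ : S.Typ) (φ : Formula S Ξ (τ :: Γ)) : Formula S Ξ Γ
  | all {Ξ : List S.NTy} {Γ : List S.Typ} (τ : S.Typ) (φ : Formula S Ξ (τ :: Γ)) : Formula S Ξ Γ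
  | new {Ξ : List S.NTy} {Γ : List S.Typ} (ν : S.NTy) (φ : Formula S (ν :: Ξ) Γ) : Formula S Ξ Γ

/-- The formulas that are goals: `⊤ | p(t₁,…,tₙ) | a # t | t ≈ u | G ∧ G' | G ∨ G' | ∃X.G | Иa.G`. -/
def Formula.IsGoal {S : Signature.{u}} :
    {Ξ : List S.NTy} → {Γ : List S.Typ} → Formula S Ξ Γ → Prop
  | _, _, .top => True
  | _, _, .bot => False
  | _, _, .pred _ _ => True
  | _, _, .fresh _ _ => True
  | _, _, .eq _ _ => True
  | _, _, .and φ ψ => φ.IsGoal ∧ ψ.IsGoal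
  | _, _, .or φ ψ => φ.IsGoal ∧ ψ.IsGoal
  | _, _, .imp _ _ => False
  | _, _, .ex _ φ => φ.IsGoal
  | _, _, .all _ _ => False
  | _, _, .new _ φ => φ.IsGoal

/-- The free names that occur in a formula. -/
def Formula.names {S : Signature.{u}} :
    {Ξ : List S.NTy} → {Γ : List S.Typ} → Formula S Ξ Γ → Set S.Name
  | _, _, .top => ∅
  | _, _, .bot => ∅
  | _, _, .pred _ ts => ⋃ i, (ts i).names
  | _, _, .fresh n t => n.names ∪ t.names
  | _, _, .eq t v => t.names ∪ v.names
  | _, _, .and φ ψ => φ.names ∪ ψ.names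
  | _, _, .or φ ψ => φ.names ∪ ψ.names
  | _, _, .imp φ ψ => φ.names ∪ ψ.names
  | _, _, .ex _ φ => φ.names
  | _, _, .all _ φ => φ.names
  | _, _, .new _ φ => φ.names

/-- Applying a map of name occurrences to a formula. -/
def Formula.ren {S : Signature.{u}} :
    {Ξ Ξ' : List S.NTy} → {Γ : List S.Typ} → NMap S Ξ Ξ' → Formula S Ξ Γ → Formula S Ξ' Γ
  | _, _, _, _, .top => .top
  | _, _, _, _, .bot => .bot
  | _, _, _, r, .pred p ts => .pred p (fun i => (ts i).ren r)
  | _, _, _, r, .fresh n t => .fresh (r _ n) (t.ren r)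
  | _, _, _, r, .eq t v => .eq (t.ren r) (v.ren r)
  | _, _, _, r, .and φ ψ => .and (φ.ren r) (ψ.ren r)
  | _, _, _, r, .or φ ψ => .or (φ.ren r) (ψ.ren r)
  | _, _, _, r, .imp φ ψ => .imp (φ.ren r) (ψ.ren r)
  | _, _, _, r, .ex τ φ => .ex τ (φ.ren r)
  | _, _, _, r, .all τ φ => .all τ (φ.ren r)
  | _, _, _, r, .new ν φ => .new ν (φ.ren (r.lift ν))

/-- The effect `π.φ` of a permutation on a formula. -/
noncomputable def Formula.perm {S : Signature.{u}} {Ξ : List S.NTy} {Γ : List S.Typ}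
    (π : Permutation S) (φ : Formula S Ξ Γ) : Formula S Ξ Γ :=
  π.foldr (fun s φ => φ.ren (NMap.swap s)) φ

/-- Capture-avoiding substitution in a formula. -/
def Formula.subst {S : Signature.{u}} :
    {Ξ : List S.NTy} → {Γ Γ' : List S.Typ} → Sub S Ξ Γ Γ' → Formula S Ξ Γ → Formula S Ξ Γ'
  | _, _, _, _, .top => .top
  | _, _, _, _, .bot => .bot
  | _, _, _, σ, .pred p ts => .pred p (fun i => (ts i).subst σ)
  | _, _, _, σ, .fresh n t => .fresh n (t.subst σ)
  | _, _, _, σ, .eq t v => .eq (t.subst σ) (v.subst σ)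
  | _, _, _, σ, .and φ ψ => .and (φ.subst σ) (ψ.subst σ)
  | _, _, _, σ, .or φ ψ => .or (φ.subst σ) (ψ.subst σ)
  | _, _, _, σ, .imp φ ψ => .imp (φ.subst σ) (ψ.subst σ)
  | _, _, _, σ, .ex τ φ => .ex τ (φ.subst (σ.lift τ))
  | _, _, _, σ, .all τ φ => .all τ (φ.subst (σ.lift τ))
  | _, _, _, σ, .new ν φ => .new ν (φ.subst (σ.weakenName ν))

/-- The substitution instance `φ[t/X]`. -/
def Formula.instVar {S : Signature.{u}} {Ξ : List S.NTy} {Γ : List S.Typ} {τ : S.Typ}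
    (φ : Formula S Ξ (τ :: Γ)) (t : Tm S Ξ Γ τ) : Formula S Ξ Γ :=
  φ.subst (Sub.inst t)

/-- The instance of the body `φ` of `Иa.φ` in which the bound name `a` is taken to be `b`. -/
def Formula.instName {S : Signature.{u}} {Ξ : List S.NTy} {Γ : List S.Typ} {ν : S.NTy}
    (φ : Formula S (ν :: Ξ) Γ) (b : S.Name) (hb : S.nty b = ν) : Formula S Ξ Γ :=
  φ.ren (NMap.inst b hb)

/-- Closure `Иa₁…aₘ.φ`. -/
def Formula.newAll {S : Signature.{u}} {Γ : List S.Typ} :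
    (Ξ : List S.NTy) → Formula S Ξ Γ → Formula S [] Γ
  | [], φ => φ
  | ν :: Ξ, φ => Formula.newAll Ξ (.new ν φ)

/-- Closure `∀X₁…Xₙ.φ`. -/
def Formula.allAll {S : Signature.{u}} {Ξ : List S.NTy} :
    (Γ : List S.Typ) → Formula S Ξ Γ → Formula S Ξ []
  | [], φ => φ
  | τ :: Γ, φ => Formula.allAll Γ (.all τ φ)

/-- Well-formed program clauses `Иa₁…aₘ.∀X₁…Xₙ.[p(t₁,…,tₖ) :- G]`: there are no free variables and
no free names. -/
structure Clause (S : Signature.{u}) where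
  /-- types of the names `a₁…aₘ` -/
  Ξ : List S.NTy
  /-- types of the variables `X₁…Xₙ` -/
  Γ : List S.Typ
  p : S.Pr
  args : ∀ i : Fin (S.pdom p).length, Tm S Ξ Γ ((S.pdom p).get i)
  body : Formula S Ξ Γ
  isGoal : body.IsGoal
  args_closed : ∀ i, (args i).names = ∅
  body_closed : body.names = ∅

/-- The nominal logic formula `Иa₁…aₘ.∀X₁…Xₙ.(G ⊃ p(t₁,…,tₖ))` that a program clause stands for. -/
def Clause.toFormula {S : Signature.{u}} (D : Clause S) : Formula S [] [] :=
  Formula.newAll D.Ξ (Formula.allAll D.Γ (.imp D.body (.pred D.p D.args)))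

/-! ## Proofs -/

/-- `Derivable Δ G`: the sequent `Δ ⟹ G` has a proof. Since `Иa.G` is taken up to renaming of
`a`, the name `a` in the rule for `И` is any name that is not free in `Иa.G`; likewise the names
bound at the front of a clause are taken to be any distinct names `ρ`. -/
inductive Derivable {S : Signature.{u}} (Δ : Set (Clause S)) : Formula S [] [] → Prop
  | top : Derivable Δ .top
  | fresh {ν : S.NTy} {τ : S.Typ} (n : NRef S [] ν) (t : Ground S τ) :
      Fresh n.atom t.eval → Derivable Δ (.fresh n t)
  | eq {τ : S.Typ} (t v : Ground S τ) : Equal t.eval v.eval → Derivable Δ (.eq t v)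
  | and (G₁ G₂ : Formula S [] []) : Derivable Δ G₁ → Derivable Δ G₂ → Derivable Δ (.and G₁ G₂)
  | or_left (G₁ G₂ : Formula S [] []) : Derivable Δ G₁ → Derivable Δ (.or G₁ G₂)
  | or_right (G₁ G₂ : Formula S [] []) : Derivable Δ G₂ → Derivable Δ (.or G₁ G₂)
  | ex {τ : S.Typ} (G : Formula S [] [τ]) (t : Ground S τ) :
      Derivable Δ (G.instVar t) → Derivable Δ (.ex τ G)
  | new {ν : S.NTy} (G : Formula S [ν] []) (a : S.Name) (ha : S.nty a = ν) :
      a ∉ G.names → Derivable Δ (G.instName a ha) → Derivable Δ (.new ν G)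
  | backchain (D : Clause S) (hD : D ∈ Δ)
      (ρ : ∀ ν : S.NTy, Idx D.Ξ ν → S.Name) (hρ : ∀ ν i, S.nty (ρ ν i) = ν)
      (ρ_inj : Function.Injective (fun x : (ν : S.NTy) × Idx D.Ξ ν => ρ x.1 x.2))
      (π : Permutation S) (θ : Sub S [] D.Γ [])
      (ts : ∀ i : Fin (S.pdom D.p).length, Ground S ((S.pdom D.p).get i)) :
      (∀ i, Equal (ts i).eval
        (Tm.perm π (((D.args i).ren (NMap.instAll ρ hρ)).subst θ)).eval) →
      Derivable Δ (Formula.perm π ((D.body.ren (NMap.instAll ρ hρ)).subst θ)) →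
      Derivable Δ (.pred D.p ts)

/-! ## Herbrand models -/

/-- The Herbrand base: atoms `p(t₁,…,tₙ)` over ground nominal terms. -/
structure GAtom (S : Signature.{u}) where
  p : S.Pr
  args : ∀ i : Fin (S.pdom p).length, GTerm S ((S.pdom p).get i)

/-- A Herbrand interpretation: an equivariant set of ground atoms up to `≈`. -/
structure Herbrand (S : Signature.{u}) where
  carrier : Set (GAtom S)
  equivariant : ∀ (s : Swapping S) (p : S.Pr)
    (ts : ∀ i : Fin (S.pdom p).length, GTerm S ((S.pdom p).get i)),
    (⟨p, ts⟩ : GAtom S) ∈ carrier → (⟨p, fun i => (ts i).swap s⟩ : GAtom S) ∈ carrier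
  respects : ∀ (p : S.Pr)
    (ts us : ∀ i : Fin (S.pdom p).length, GTerm S ((S.pdom p).get i)),
    (∀ i, Equal (ts i) (us i)) → (⟨p, ts⟩ : GAtom S) ∈ carrier → (⟨p, us⟩ : GAtom S) ∈ carrier

/-- Number of connectives, for recursion on formulas. -/
def Formula.size {S : Signature.{u}} :
    {Ξ : List S.NTy} → {Γ : List S.Typ} → Formula S Ξ Γ → ℕ
  | _, _, .top => 0
  | _, _, .bot => 0
  | _, _, .pred _ _ => 0
  | _, _, .fresh _ _ => 0
  | _, _, .eq _ _ => 0
  | _, _, .and φ ψ => φ.size + ψ.size + 1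
  | _, _, .or φ ψ => φ.size + ψ.size + 1
  | _, _, .imp φ ψ => φ.size + ψ.size + 1
  | _, _, .ex _ φ => φ.size + 1
  | _, _, .all _ φ => φ.size + 1
  | _, _, .new _ φ => φ.size + 1

theorem Formula.size_ren {S : Signature.{u}} {Ξ Ξ' : List S.NTy} {Γ : List S.Typ}
    (r : NMap S Ξ Ξ') (φ : Formula S Ξ Γ) : (φ.ren r).size = φ.size := by
  induction φ generalizing Ξ' <;> simp_all [Formula.ren, Formula.size]

theorem Formula.size_subst {S : Signature.{u}} {Ξ : List S.NTy} {Γ Γ' : List S.Typ}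
    (σ : Sub S Ξ Γ Γ') (φ : Formula S Ξ Γ) : (φ.subst σ).size = φ.size := by
  induction φ generalizing Γ' <;> simp_all [Formula.subst, Formula.size]

/-- Satisfaction `H ⊨ φ` of a formula without free variables in a Herbrand interpretation.
`Иa.φ` holds if `φ` holds for some fresh
name `a`; as `H` is equivariant, this is the same as for all fresh names. -/
def Sat {S : Signature.{u}} (H : Herbrand S) : Formula S [] [] → Prop
  | .top => True
  | .bot => False
  | .pred p ts => (⟨p, fun i => (ts i).eval⟩ : GAtom S) ∈ H.carrier
  | .fresh n t => Fresh n.atom t.eval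
  | .eq t v => Equal t.eval v.eval
  | .and φ ψ => Sat H φ ∧ Sat H ψ
  | .or φ ψ => Sat H φ ∨ Sat H ψ
  | .imp φ ψ => Sat H φ → Sat H ψ
  | .ex τ φ => ∃ t : Ground S τ, Sat H (φ.instVar t)
  | .all τ φ => ∀ t : Ground S τ, Sat H (φ.instVar t)
  | .new ν φ => ∃ (b : S.Name) (hb : S.nty b = ν), b ∉ φ.names ∧ Sat H (φ.instName b hb)
termination_by φ => φ.size
decreasing_by
  all_goals
    simp only [Formula.instVar, Formula.instName, Formula.size_ren, Formula.size_subst,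
      Formula.size]
    omega

/-- `Φ ⊨ φ`: every Herbrand model of all the formulas in `Φ` is a model of `φ`. -/
def Entails {S : Signature.{u}} (Φ : Set (Formula S [] [])) (φ : Formula S [] []) : Prop :=
  ∀ H : Herbrand S, (∀ ψ ∈ Φ, Sat H ψ) → Sat H φ

end AlphaProlog

/-!
The argument is the one for Horn clauses, carried out up to permutations of names.

The equality `≈` of ground nominal terms is an equivariant equivalence relation that respects
freshness. Transitivity, `Equal.trans`, is the delicate part: for `⟨a⟩t ≈ ⟨b⟩v ≈ ⟨c⟩w` one has
`(a b)(b c)·w = (a c)(a b)·w`, where `(a b)·w ≈ w` because `a` and `b` are fresh for `w`. Because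
a derivation may begin with any permutation and uses the arguments of an atom only up to `≈`,
provability is equivariant (`Derivable.ren_swap`) and provability of an atom depends only on its
arguments up to `≈` (`Derivable.pred_congr`). Satisfaction is equivariant as well
(`Sat.ren_swap`), which yields the some/any property of `И` (`Sat.instName_of_new`). With it, a
Herbrand interpretation satisfies a clause if and only if it satisfies the implication from body
to head for every choice of pairwise distinct names and of ground terms
(`Clause.sat_toFormula_iff`).

Soundness (`Derivable.sat`) is an induction on derivations. For a backchaining step with
permutation `π`, equivariance removes `π` from the body and restores it on the head.

For completeness, the provable atoms form a Herbrand interpretation `provableAtoms Δ`. Every goal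
that it satisfies is provable (`derivable_of_sat_provableAtoms`), because each connective of goals
has a right rule that mirrors its satisfaction clause. Hence it is a model of `Δ`
(`sat_provableAtoms_toFormula`): if the body of a clause instance is satisfied, it is provable, and
backchaining with the identity permutation proves the head. A goal entailed by `Δ` holds in this
model, and so it is provable.
-/

namespace AlphaProlog

/-! ### Swapping, freshness and equality of ground nominal terms -/

namespace Swapping

variable {S : Signature.{u}} (s : Swapping S)

theorem onName_fst : s.onName s.fst = s.snd := by
  simp [onName]

theorem onName_snd : s.onName s.snd = s.fst := by
  simp [onName]

theorem onName_of_ne {c : S.Name} (h₁ : c ≠ s.fst) (h₂ : c ≠ s.snd) : s.onName c = c :=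
  @Equiv.swap_apply_of_ne_of_ne _ (Classical.decEq _) _ _ _ h₁ h₂

@[simp] theorem onName_onName (c : S.Name) : s.onName (s.onName c) = c := by
  simp [onName]

theorem onName_injective : Function.Injective s.onName :=
  Function.LeftInverse.injective s.onName_onName

@[simp] theorem onName_inj {c d : S.Name} : s.onName c = s.onName d ↔ c = d :=
  s.onName_injective.eq_iff

/-- The image `(s·a s·b)` of the swapping `(a b)` under another swapping `s`. -/
noncomputable def conj (s' : Swapping S) : Swapping S :=
  ⟨s.onName s'.fst, s.onName s'.snd, by rw [s.nty_onName, s.nty_onName, s'.same]⟩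

theorem conj_onName (s' : Swapping S) (c : S.Name) :
    (s.conj s').onName (s.onName c) = s.onName (s'.onName c) := by
  by_cases h₁ : c = s'.fst
  · subst h₁
    rw [onName_fst]
    exact onName_fst (s.conj s')
  by_cases h₂ : c = s'.snd
  · subst h₂
    rw [onName_snd]
    exact onName_snd (s.conj s')
  rw [onName_of_ne s' h₁ h₂, onName_of_ne]
  · simpa [conj] using h₁
  · simpa [conj] using h₂

end Swapping

section GTerm

variable {S : Signature.{u}}

@[simp] theorem GTerm.swap_swap_self (s : Swapping S) {τ : S.Typ} (t : GTerm S τ) :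
    (t.swap s).swap s = t := by
  induction t with
  | name a h => simp [GTerm.swap]
  | app f h ts ih => simp [GTerm.swap, ih]
  | abs a h t ih => simp [GTerm.swap, ih]

theorem GTerm.swap_conj (s s' : Swapping S) {τ : S.Typ} (t : GTerm S τ) :
    (t.swap s).swap (s.conj s') = (t.swap s').swap s := by
  induction t with
  | name a h => simp [GTerm.swap, Swapping.conj_onName]
  | app f h ts ih => simp [GTerm.swap, ih]
  | abs a h t ih => simp [GTerm.swap, ih, Swapping.conj_onName]

theorem GTerm.swap_symm {a b : S.Name} (h : S.nty a = S.nty b) {τ : S.Typ} (t : GTerm S τ) :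
    t.swap ⟨a, b, h⟩ = t.swap ⟨b, a, h.symm⟩ := by
  have key : ∀ c, Swapping.onName ⟨a, b, h⟩ c = Swapping.onName ⟨b, a, h.symm⟩ c := fun c => by
    rw [Swapping.onName, @Equiv.swap_comm _ (Classical.decEq _), Swapping.onName]
  induction t with
  | name a h => simp [GTerm.swap, key]
  | app f h ts ih => simp [GTerm.swap, ih]
  | abs a h t ih => simp [GTerm.swap, ih, key]

theorem GTerm.swap_self {a : S.Name} (h : S.nty a = S.nty a) {τ : S.Typ} (t : GTerm S τ) :
    t.swap ⟨a, a, h⟩ = t := by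
  have key : ∀ c, Swapping.onName ⟨a, a, h⟩ c = c := fun c => by
    simp [Swapping.onName]
  induction t with
  | name a h => simp [GTerm.swap, key]
  | app f h ts ih => simp [GTerm.swap, ih]
  | abs a h t ih => simp [GTerm.swap, ih, key]

theorem Fresh.swap (s : Swapping S) {a : S.Name} {τ : S.Typ} {t : GTerm S τ} (h : Fresh a t) :
    Fresh (s.onName a) (t.swap s) := by
  induction h with
  | name b h hne => exact .name _ _ (by simpa using hne)
  | app f h ts _ ih => exact .app _ _ _ ih
  | abs_same h t => exact .abs_same _ _
  | abs_other b h t hne _ ih => exact .abs_other _ _ _ (by simpa using hne) ih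

theorem Equal.swap (s : Swapping S) {τ : S.Typ} {t v : GTerm S τ} (h : Equal t v) :
    Equal (t.swap s) (v.swap s) := by
  induction h with
  | name a h => exact .name _ _
  | app f h ts us _ ih => exact .app _ _ _ _ ih
  | abs_same a h t v _ ih => exact .abs_same _ _ _ _ ih
  | abs_other a b ha hb t v hf _ ih =>
    refine .abs_other _ _ _ _ _ _ (hf.swap s) ?_
    rw [← GTerm.swap_conj] at ih
    exact ih

theorem Equal.refl {τ : S.Typ} (t : GTerm S τ) : Equal t t := by
  induction t with
  | name a h => exact .name _ _
  | app f h ts ih => exact .app _ _ _ _ ih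
  | abs a h t ih => exact .abs_same _ _ _ _ ih

theorem Fresh.abs_inv {c a : S.Name} {ν : S.NTy} {τ : S.Typ} {h : S.nty a = ν} {t : GTerm S τ}
    (hf : Fresh c (GTerm.abs a h t)) : c = a ∨ (c ≠ a ∧ Fresh c t) := by
  cases hf with
  | abs_same => exact .inl rfl
  | abs_other _ _ _ hne hf => exact .inr ⟨hne, hf⟩

/-- Freshness of a third name is unaffected by a swapping. -/
theorem Fresh.of_swap {c a b : S.Name} (h : S.nty a = S.nty b) {τ : S.Typ} {t : GTerm S τ}
    (hf : Fresh c (t.swap ⟨a, b, h⟩)) (h₁ : c ≠ a) (h₂ : c ≠ b) : Fresh c t := by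
  have := hf.swap ⟨a, b, h⟩
  rwa [Swapping.onName_of_ne _ h₁ h₂, GTerm.swap_swap_self] at this

theorem Fresh.swap_snd {a b : S.Name} (h : S.nty a = S.nty b) {τ : S.Typ} {t : GTerm S τ}
    (hf : Fresh a t) : Fresh b (t.swap ⟨a, b, h⟩) := by
  have := hf.swap ⟨a, b, h⟩
  rwa [Swapping.onName_fst ⟨a, b, h⟩] at this

theorem Fresh.swap_of_ne {c a b : S.Name} (h : S.nty a = S.nty b) {τ : S.Typ} {t : GTerm S τ}
    (hf : Fresh c t) (h₁ : c ≠ a) (h₂ : c ≠ b) : Fresh c (t.swap ⟨a, b, h⟩) := by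
  have := hf.swap ⟨a, b, h⟩
  rwa [Swapping.onName_of_ne _ h₁ h₂] at this

theorem Equal.fresh_iff {τ : S.Typ} {t v : GTerm S τ} (h : Equal t v) (c : S.Name) :
    Fresh c t ↔ Fresh c v := by
  induction h with
  | name a h => rfl
  | app f h ts us _ ih =>
    constructor
    · rintro ⟨⟩
      rename_i hf
      exact .app _ _ _ fun i => (ih i).1 (hf i)
    · rintro ⟨⟩
      rename_i hf
      exact .app _ _ _ fun i => (ih i).2 (hf i)
  | abs_same a h t v _ ih =>
    constructor
    · intro hf
      rcases hf.abs_inv with rfl | ⟨hne, hf⟩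
      · exact .abs_same _ _
      · exact .abs_other _ _ _ hne (ih.1 hf)
    · intro hf
      rcases hf.abs_inv with rfl | ⟨hne, hf⟩
      · exact .abs_same _ _
      · exact .abs_other _ _ _ hne (ih.2 hf)
  | abs_other a b ha hb t v hav _ ih =>
    constructor
    · intro hf
      rcases eq_or_ne c b with rfl | hcb
      · exact .abs_same _ _
      refine .abs_other _ _ _ hcb ?_
      rcases hf.abs_inv with rfl | ⟨hne, hf⟩
      · exact hav
      · exact (ih.1 hf).of_swap _ hne hcb
    · intro hf
      rcases eq_or_ne c a with rfl | hca
      · exact .abs_same _ _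
      refine .abs_other _ _ _ hca (ih.2 ?_)
      rcases hf.abs_inv with rfl | ⟨hne, hf⟩
      · exact hav.swap_snd _
      · exact hf.swap_of_ne _ hca hne

theorem Equal.symm {τ : S.Typ} {t v : GTerm S τ} (h : Equal t v) : Equal v t := by
  induction h with
  | name a h => exact .name _ _
  | app f h ts us _ ih => exact .app _ _ _ _ ih
  | abs_same a h t v _ ih => exact .abs_same _ _ _ _ ih
  | abs_other a b ha hb t v hf hE ih =>
    refine .abs_other _ _ _ _ _ _ ((hE.fresh_iff b).2 (hf.swap_snd _)) ?_
    have := ih.swap ⟨a, b, ha.trans hb.symm⟩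
    rwa [GTerm.swap_swap_self, GTerm.swap_symm] at this

/-- Swapping two names that are fresh for a term does not change it up to `≈`. -/
theorem Equal.swap_of_fresh {a b : S.Name} (h : S.nty a = S.nty b) {τ : S.Typ} {t : GTerm S τ}
    (ha : Fresh a t) (hb : Fresh b t) : Equal (t.swap ⟨a, b, h⟩) t := by
  rcases eq_or_ne a b with rfl | hab
  · rw [GTerm.swap_self]
    exact Equal.refl t
  induction t with
  | name c hc =>
    cases ha with | name _ _ ha => ?_
    cases hb with | name _ _ hb => ?_
    simp only [GTerm.swap, Swapping.onName_of_ne ⟨a, b, h⟩ ha.symm hb.symm]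
    exact .name _ _
  | app f hf ts ih =>
    cases ha with | app _ _ _ ha => ?_
    cases hb with | app _ _ _ hb => ?_
    exact .app _ _ _ _ fun i => ih i (ha i) (hb i)
  | abs c hc t ih =>
    simp only [GTerm.swap]
    rcases ha.abs_inv with rfl | ⟨hac, ha'⟩
    · rcases hb.abs_inv with rfl | ⟨hbc, hb'⟩
      · exact absurd rfl hab
      simp only [Swapping.onName_fst ⟨a, b, h⟩]
      refine .abs_other _ _ _ _ _ _ hb' ?_
      rw [GTerm.swap_symm]
      exact Equal.refl _
    · rcases hb.abs_inv with rfl | ⟨hbc, hb'⟩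
      · simp only [Swapping.onName_snd ⟨a, b, h⟩]
        exact .abs_other _ _ _ _ _ _ ha' (Equal.refl _)
      · simp only [Swapping.onName_of_ne ⟨a, b, h⟩ hac.symm hbc.symm]
        exact .abs_same _ _ _ _ (ih ha' hb')

/-- The two rules for equality of abstractions as one: since `(a a)·v = v`, the rule for
distinct names also covers equal names once its freshness premise is dropped for them. -/
theorem Equal.abs_iff {a b : S.Name} {ν : S.NTy} {τ : S.Typ} {ha : S.nty a = ν} {hb : S.nty b = ν}
    {t v : GTerm S τ} : Equal (GTerm.abs a ha t) (GTerm.abs b hb v) ↔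
      (a = b ∨ Fresh a v) ∧ Equal t (v.swap ⟨a, b, ha.trans hb.symm⟩) := by
  constructor
  · intro h
    cases h with
    | abs_same _ _ _ _ h => exact ⟨.inl rfl, by rwa [GTerm.swap_self]⟩
    | abs_other _ _ _ _ _ _ hf h => exact ⟨.inr hf, h⟩
  · rintro ⟨rfl | hf, h⟩
    · rw [GTerm.swap_self] at h
      exact .abs_same _ _ _ _ h
    · exact .abs_other _ _ _ _ _ _ hf h

theorem Equal.trans {τ : S.Typ} {t v w : GTerm S τ} (h₁ : Equal t v) (h₂ : Equal v w) :
    Equal t w := by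
  induction t with
  | name a h =>
    cases h₁
    exact h₂
  | app f h ts ih =>
    cases h₁ with | app _ _ _ us h₁ => ?_
    cases h₂ with | app _ _ _ ws h₂ => ?_
    exact .app _ _ _ _ fun i => ih i (h₁ i) (h₂ i)
  | @abs ν τ a ha t ih =>
    obtain ⟨b, hb, v, rfl⟩ : ∃ b hb v', v = GTerm.abs (ν := ν) b hb v' := by
      cases h₁ <;> exact ⟨_, _, _, rfl⟩
    obtain ⟨c, hc, w, rfl⟩ : ∃ c hc w', w = GTerm.abs (ν := ν) c hc w' := by
      cases h₂ <;> exact ⟨_, _, _, rfl⟩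
    have haw : Fresh a (GTerm.abs c hc w) :=
      (h₂.fresh_iff a).1 ((h₁.fresh_iff a).1 (.abs_same _ _))
    rw [Equal.abs_iff] at h₁ h₂ ⊢
    obtain ⟨hav, h₁⟩ := h₁
    obtain ⟨hbw, h₂⟩ := h₂
    refine ⟨haw.abs_inv.imp id And.right, ?_⟩
    have h₃ := ih h₁ (h₂.swap _)
    rcases eq_or_ne a b with rfl | hab
    · rwa [GTerm.swap_self] at h₃
    rcases eq_or_ne b c with rfl | hbc
    · rwa [GTerm.swap_self] at h₃
    rcases eq_or_ne a c with rfl | hac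
    · rw [GTerm.swap_symm, GTerm.swap_swap_self] at h₃
      rwa [GTerm.swap_self]
    have haw : Fresh a w := haw.abs_inv.resolve_left hac |>.2
    have hbw : Fresh b w := hbw.resolve_left hbc
    -- `(a b)(b c)·w = (a c)(a b)·w`, and `(a b)·w ≈ w` as `a` and `b` are fresh for `w`
    refine ih h₃ ?_
    rw [← GTerm.swap_conj]
    have hs : Swapping.conj ⟨a, b, ha.trans hb.symm⟩ ⟨b, c, hb.trans hc.symm⟩ =
        ⟨a, c, ha.trans hc.symm⟩ := by
      simp only [Swapping.conj, Swapping.mk.injEq]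
      exact ⟨Swapping.onName_snd ⟨a, b, _⟩, Swapping.onName_of_ne _ hac.symm hbc.symm⟩
    rw [hs]
    exact (Equal.swap_of_fresh _ haw hbw).swap _

end GTerm

/-! ### Renaming of name occurrences and substitution -/

section RenamingAndSubstitution

variable {S : Signature.{u}}

namespace NMap

variable {Ξ Ξ' Ξ'' : List S.NTy}

/-- Composition of maps of name occurrences; `r` acts first. -/
def comp (r' : NMap S Ξ' Ξ'') (r : NMap S Ξ Ξ') : NMap S Ξ Ξ'' :=
  fun ν n => r' ν (r ν n)

theorem lift_weaken (r : NMap S Ξ Ξ') (μ ν : S.NTy) (n : NRef S Ξ ν) :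
    r.lift μ ν (weaken μ ν n) = weaken μ ν (r ν n) := by
  cases n <;> rfl

theorem lift_comp (r' : NMap S Ξ' Ξ'') (r : NMap S Ξ Ξ') (μ : S.NTy) :
    (r'.comp r).lift μ = (r'.lift μ).comp (r.lift μ) := by
  funext ν n
  match ν, n with
  | _, .free a h => exact (lift_weaken r' μ _ _).symm
  | _, .bound .zero => rfl
  | _, .bound (.succ i) => exact (lift_weaken r' μ _ _).symm

theorem lift_swap (s : Swapping S) (μ : S.NTy) : (swap s : NMap S Ξ Ξ).lift μ = swap s := by
  funext ν n
  match ν, n with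
  | _, .free a h => rfl
  | _, .bound .zero => rfl
  | _, .bound (.succ i) => rfl

theorem swap_comp_swap (s : Swapping S) (ν : S.NTy) (n : NRef S Ξ ν) :
    swap s ν (swap s ν n) = n := by
  cases n <;> simp [swap]

theorem swap_comp_inst (s : Swapping S) {μ : S.NTy} (b : S.Name) (hb : S.nty b = μ) :
    (swap s).comp (inst b hb : NMap S (μ :: Ξ) Ξ) =
      (inst (s.onName b) ((s.nty_onName b).trans hb)).comp (swap s) := by
  funext ν n
  match ν, n with
  | _, .free a h => rfl
  | _, .bound .zero => rfl
  | _, .bound (.succ i) => rfl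

/-- Agreement of two maps of name occurrences on the bound names and on the free names in `A`. -/
def EqOn (A : Set S.Name) (r r' : NMap S Ξ Ξ') : Prop :=
  (∀ ν (i : Idx Ξ ν), r ν (.bound i) = r' ν (.bound i)) ∧
    ∀ ν a (h : S.nty a = ν), a ∈ A → r ν (.free a h) = r' ν (.free a h)

theorem EqOn.mono {A B : Set S.Name} {r r' : NMap S Ξ Ξ'} (h : EqOn B r r') (hAB : A ⊆ B) :
    EqOn A r r' :=
  ⟨h.1, fun ν a ha hA => h.2 ν a ha (hAB hA)⟩

theorem EqOn.lift {A : Set S.Name} {r r' : NMap S Ξ Ξ'} (h : EqOn A r r') (μ : S.NTy) :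
    EqOn A (r.lift μ) (r'.lift μ) := by
  refine ⟨fun ν i => ?_, fun ν a ha hA => congrArg (weaken μ ν) (h.2 ν a ha hA)⟩
  cases i with
  | zero => rfl
  | succ i => exact congrArg (weaken μ ν) (h.1 ν i)

theorem EqOn.apply {A : Set S.Name} {r r' : NMap S Ξ Ξ'} (h : EqOn A r r') {ν : S.NTy}
    (n : NRef S Ξ ν) (hn : n.names ⊆ A) : r ν n = r' ν n := by
  cases n with
  | free a ha => exact h.2 ν a ha (hn rfl)
  | bound i => exact h.1 ν i

end NMap

section Ren

variable {Ξ Ξ' Ξ'' : List S.NTy} {Γ Γ' Γ'' : List S.Typ}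

theorem Tm.ren_ren (r' : NMap S Ξ' Ξ'') (r : NMap S Ξ Ξ') {τ : S.Typ} (t : Tm S Ξ Γ τ) :
    (t.ren r).ren r' = t.ren (r'.comp r) := by
  induction t <;> simp_all [Tm.ren, NMap.comp]

theorem Formula.ren_ren (r' : NMap S Ξ' Ξ'') (r : NMap S Ξ Ξ') (φ : Formula S Ξ Γ) :
    (φ.ren r).ren r' = φ.ren (r'.comp r) := by
  induction φ generalizing Ξ' Ξ'' with
  | new ν φ ih => simp [Formula.ren, ih, NMap.lift_comp]
  | fresh n t => simp [Formula.ren, Tm.ren_ren, NMap.comp]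
  | _ => simp_all [Formula.ren, Tm.ren_ren]

theorem Tm.ren_congr {r r' : NMap S Ξ Ξ'} {τ : S.Typ} (t : Tm S Ξ Γ τ)
    (h : NMap.EqOn t.names r r') : t.ren r = t.ren r' := by
  induction t with
  | name n => simp [Tm.ren, h.apply n subset_rfl]
  | var x => rfl
  | app f hf ts ih =>
    simp only [Tm.ren, Tm.app.injEq, heq_eq_eq, true_and]
    exact funext fun i => ih i (h.mono (Set.subset_iUnion (fun i => (ts i).names) i))
  | swap m n t ih =>
    rw [Tm.ren, Tm.ren, ih (h.mono Set.subset_union_right),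
      h.apply m (Set.subset_union_left.trans Set.subset_union_left),
      h.apply n (Set.subset_union_right.trans Set.subset_union_left)]
  | abs n t ih =>
    rw [Tm.ren, Tm.ren, ih (h.mono Set.subset_union_right), h.apply n Set.subset_union_left]

theorem Formula.ren_congr {r r' : NMap S Ξ Ξ'} (φ : Formula S Ξ Γ)
    (h : NMap.EqOn φ.names r r') : φ.ren r = φ.ren r' := by
  induction φ generalizing Ξ' with
  | top => rfl
  | bot => rfl
  | pred p ts =>
    simp only [Formula.ren, Formula.pred.injEq, heq_eq_eq, true_and]
    exact funext fun i =>
      (ts i).ren_congr (h.mono (Set.subset_iUnion (fun i => (ts i).names) i))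
  | fresh n t =>
    rw [Formula.ren, Formula.ren, h.apply n Set.subset_union_left,
      t.ren_congr (h.mono Set.subset_union_right)]
  | eq t v =>
    rw [Formula.ren, Formula.ren, t.ren_congr (h.mono Set.subset_union_left),
      v.ren_congr (h.mono Set.subset_union_right)]
  | and φ ψ ih₁ ih₂ | or φ ψ ih₁ ih₂ | imp φ ψ ih₁ ih₂ =>
    rw [Formula.ren, Formula.ren, ih₁ (h.mono Set.subset_union_left),
      ih₂ (h.mono Set.subset_union_right)]
  | ex τ φ ih | all τ φ ih => rw [Formula.ren, Formula.ren, ih h]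
  | new ν φ ih => rw [Formula.ren, Formula.ren, ih (h.lift ν)]

theorem Tm.ren_subst (r : NMap S Ξ Ξ') (σ : Sub S Ξ Γ Γ') {τ : S.Typ} (t : Tm S Ξ Γ τ) :
    (t.subst σ).ren r = (t.ren r).subst (fun κ x => (σ κ x).ren r) := by
  induction t <;> simp_all [Tm.ren, Tm.subst]

theorem Sub.ren_lift (r : NMap S Ξ Ξ') (σ : Sub S Ξ Γ Γ') (κ : S.Typ) :
    (fun τ x => (σ.lift κ τ x).ren r) = Sub.lift (fun τ x => (σ τ x).ren r) κ := by
  funext τ x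
  cases x with
  | zero => rfl
  | succ x => exact Tm.ren_subst r _ _

theorem Sub.ren_weakenName (r : NMap S Ξ Ξ') (σ : Sub S Ξ Γ Γ') (μ : S.NTy) :
    (fun τ x => (σ.weakenName μ τ x).ren (r.lift μ)) =
      Sub.weakenName (fun τ x => (σ τ x).ren r) μ := by
  funext τ x
  simp only [Sub.weakenName, Tm.ren_ren]
  congr 1
  funext ν n
  exact NMap.lift_weaken r μ ν n

theorem Formula.ren_subst (r : NMap S Ξ Ξ') (σ : Sub S Ξ Γ Γ') (φ : Formula S Ξ Γ) :
    (φ.subst σ).ren r = (φ.ren r).subst (fun κ x => (σ κ x).ren r) := by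
  induction φ generalizing Ξ' Γ' <;>
    simp_all [Formula.ren, Formula.subst, Tm.ren_subst, Sub.ren_lift, Sub.ren_weakenName]

theorem Tm.subst_subst (σ' : Sub S Ξ Γ' Γ'') (σ : Sub S Ξ Γ Γ') {τ : S.Typ} (t : Tm S Ξ Γ τ) :
    (t.subst σ).subst σ' = t.subst (fun κ x => (σ κ x).subst σ') := by
  induction t <;> simp_all [Tm.subst]

theorem Tm.subst_var {τ : S.Typ} (t : Tm S Ξ Γ τ) : t.subst (fun _ x => .var x) = t := by
  induction t <;> simp_all [Tm.subst]

theorem Sub.lift_subst_lift (σ' : Sub S Ξ Γ' Γ'') (σ : Sub S Ξ Γ Γ') (κ : S.Typ) :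
    (fun τ x => (σ.lift κ τ x).subst (σ'.lift κ)) =
      Sub.lift (fun τ x => (σ τ x).subst σ') κ := by
  funext τ x
  cases x with
  | zero => rfl
  | succ x => simp only [Sub.lift, Tm.subst_subst, Tm.subst]

theorem Sub.weakenName_subst_weakenName (σ' : Sub S Ξ Γ' Γ'') (σ : Sub S Ξ Γ Γ') (μ : S.NTy) :
    (fun τ x => (σ.weakenName μ τ x).subst (σ'.weakenName μ)) =
      Sub.weakenName (fun τ x => (σ τ x).subst σ') μ := by
  funext τ x
  exact (Tm.ren_subst _ _ _).symm

theorem Formula.subst_subst (σ' : Sub S Ξ Γ' Γ'') (σ : Sub S Ξ Γ Γ') (φ : Formula S Ξ Γ) :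
    (φ.subst σ).subst σ' = φ.subst (fun κ x => (σ κ x).subst σ') := by
  induction φ generalizing Γ' Γ'' <;>
    simp_all [Formula.subst, Tm.subst_subst, Sub.lift_subst_lift,
      Sub.weakenName_subst_weakenName]

theorem Sub.lift_var (κ : S.Typ) :
    Sub.lift (fun _ x => .var x : Sub S Ξ Γ Γ) κ = fun _ x => .var x := by
  funext τ x
  cases x <;> rfl

theorem Formula.subst_var (φ : Formula S Ξ Γ) : φ.subst (fun _ x => .var x) = φ := by
  have hw : ∀ Ξ Γ μ, Sub.weakenName (fun _ x => .var x : Sub S Ξ Γ Γ) μ = fun _ x => .var x :=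
    fun _ _ _ => rfl
  induction φ <;> simp_all [Formula.subst, Tm.subst_var, Sub.lift_var]

/-- The substitution `[t/X, σ]`, where `X` is the innermost variable. -/
def Sub.cons {κ : S.Typ} (σ : Sub S Ξ Γ Γ') (t : Tm S Ξ Γ' κ) : Sub S Ξ (κ :: Γ) Γ'
  | _, .zero => t
  | _, .succ x => σ _ x

/-- Instantiating the variable `κ` after a substitution `σ` under its binder amounts to one
simultaneous substitution. -/
theorem Formula.instVar_subst_lift {κ : S.Typ} (φ : Formula S Ξ (κ :: Γ)) (σ : Sub S Ξ Γ Γ')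
    (t : Tm S Ξ Γ' κ) :
    (φ.subst (σ.lift κ)).instVar t = φ.subst (σ.cons t) := by
  rw [Formula.instVar, Formula.subst_subst]
  congr 1
  funext τ x
  cases x with
  | zero => rfl
  | succ x =>
    simp only [Sub.lift, Tm.subst_subst, Tm.subst]
    exact Tm.subst_var _

theorem Formula.instVar_ren {κ : S.Typ} (φ : Formula S Ξ (κ :: Γ)) (r : NMap S Ξ Ξ')
    (t : Tm S Ξ Γ κ) : (φ.instVar t).ren r = (φ.ren r).instVar (t.ren r) := by
  rw [Formula.instVar, Formula.ren_subst, Formula.instVar]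
  congr 1
  funext τ x
  cases x <;> rfl

theorem Formula.instName_ren_swap {μ : S.NTy} (φ : Formula S (μ :: Ξ) Γ) (s : Swapping S)
    (b : S.Name) (hb : S.nty b = μ) :
    (φ.instName b hb).ren (NMap.swap s) =
      (φ.ren (NMap.swap s)).instName (s.onName b) ((s.nty_onName b).trans hb) := by
  rw [Formula.instName, Formula.instName, Formula.ren_ren, Formula.ren_ren, NMap.swap_comp_inst]

theorem Tm.ren_id {r : NMap S Ξ Ξ} (hr : ∀ ν n, r ν n = n) {τ : S.Typ} (t : Tm S Ξ Γ τ) :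
    t.ren r = t := by
  induction t <;> simp_all [Tm.ren]

theorem NMap.lift_id {r : NMap S Ξ Ξ} (hr : ∀ ν n, r ν n = n) (μ ν : S.NTy)
    (n : NRef S (μ :: Ξ) ν) : r.lift μ ν n = n := by
  match ν, n with
  | _, .free a h => simp [NMap.lift, hr, NMap.weaken]
  | _, .bound .zero => rfl
  | _, .bound (.succ i) => simp [NMap.lift, hr, NMap.weaken]

theorem Formula.ren_id {r : NMap S Ξ Ξ} (hr : ∀ ν n, r ν n = n) (φ : Formula S Ξ Γ) :
    φ.ren r = φ := by
  induction φ with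
  | new ν φ ih => rw [Formula.ren, ih (NMap.lift_id hr ν)]
  | _ => simp_all [Formula.ren, Tm.ren_id]

@[simp] theorem Tm.ren_swap_swap (s : Swapping S) {τ : S.Typ} (t : Tm S Ξ Γ τ) :
    (t.ren (NMap.swap s)).ren (NMap.swap s) = t := by
  rw [Tm.ren_ren]
  exact t.ren_id (NMap.swap_comp_swap s)

@[simp] theorem Formula.ren_swap_swap (s : Swapping S) (φ : Formula S Ξ Γ) :
    (φ.ren (NMap.swap s)).ren (NMap.swap s) = φ := by
  rw [Formula.ren_ren]
  exact φ.ren_id (NMap.swap_comp_swap s)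

end Ren

/-! ### Free names -/

section Names

variable {Ξ Ξ' : List S.NTy} {Γ : List S.Typ}

theorem NRef.names_finite {ν : S.NTy} (n : NRef S Ξ ν) : n.names.Finite := by
  cases n <;> simp [NRef.names]

theorem Tm.names_finite {τ : S.Typ} (t : Tm S Ξ Γ τ) : t.names.Finite := by
  induction t with
  | name n => exact n.names_finite
  | var x => exact Set.finite_empty
  | app f h ts ih => exact Set.finite_iUnion ih
  | swap m n t ih => exact (m.names_finite.union n.names_finite).union ih
  | abs n t ih => exact n.names_finite.union ih

theorem Formula.names_finite (φ : Formula S Ξ Γ) : φ.names.Finite := by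
  induction φ with
  | top | bot => exact Set.finite_empty
  | pred p ts => exact Set.finite_iUnion fun i => (ts i).names_finite
  | fresh n t => exact n.names_finite.union t.names_finite
  | eq t v => exact t.names_finite.union v.names_finite
  | and _ _ ih₁ ih₂ | or _ _ ih₁ ih₂ | imp _ _ ih₁ ih₂ => exact ih₁.union ih₂
  | ex _ _ ih | all _ _ ih | new _ _ ih => exact ih

/-- Each free name of `t.ren r` occurs in the image under `r` of a bound name or of a free name
of `t`. -/
theorem Tm.exists_of_mem_names_ren (r : NMap S Ξ Ξ') {τ : S.Typ} (t : Tm S Ξ Γ τ) {c : S.Name}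
    (hc : c ∈ (t.ren r).names) :
    ∃ (ν : S.NTy) (n : NRef S Ξ ν), n.names ⊆ t.names ∧ c ∈ (r ν n).names := by
  induction t with
  | name n => exact ⟨_, n, subset_rfl, hc⟩
  | var x => exact hc.elim
  | app f h ts ih =>
    obtain ⟨i, hi⟩ := Set.mem_iUnion.1 hc
    obtain ⟨ν, n, hn, hcn⟩ := ih i hi
    exact ⟨ν, n, hn.trans (Set.subset_iUnion (fun i => (ts i).names) i), hcn⟩
  | swap m n t ih =>
    rcases hc with (hc | hc) | hc
    · exact ⟨_, m, Set.subset_union_left.trans Set.subset_union_left, hc⟩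
    · exact ⟨_, n, Set.subset_union_right.trans Set.subset_union_left, hc⟩
    · obtain ⟨ν, n, hn, hcn⟩ := ih hc
      exact ⟨ν, n, hn.trans Set.subset_union_right, hcn⟩
  | abs m t ih =>
    rcases hc with hc | hc
    · exact ⟨_, m, Set.subset_union_left, hc⟩
    · obtain ⟨ν, n, hn, hcn⟩ := ih hc
      exact ⟨ν, n, hn.trans Set.subset_union_right, hcn⟩

theorem NMap.names_weaken {μ ν : S.NTy} (n : NRef S Ξ ν) :
    (NMap.weaken μ ν n).names = n.names := by
  cases n <;> rfl

theorem Formula.exists_of_mem_names_ren (r : NMap S Ξ Ξ') (φ : Formula S Ξ Γ) {c : S.Name}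
    (hc : c ∈ (φ.ren r).names) :
    ∃ (ν : S.NTy) (n : NRef S Ξ ν), n.names ⊆ φ.names ∧ c ∈ (r ν n).names := by
  induction φ generalizing Ξ' with
  | top | bot => exact hc.elim
  | pred p ts =>
    obtain ⟨i, hi⟩ := Set.mem_iUnion.1 hc
    obtain ⟨ν, n, hn, hcn⟩ := (ts i).exists_of_mem_names_ren r hi
    exact ⟨ν, n, hn.trans (Set.subset_iUnion (fun i => (ts i).names) i), hcn⟩
  | fresh m t =>
    rcases hc with hc | hc
    · exact ⟨_, m, Set.subset_union_left, hc⟩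
    · obtain ⟨ν, n, hn, hcn⟩ := t.exists_of_mem_names_ren r hc
      exact ⟨ν, n, hn.trans Set.subset_union_right, hcn⟩
  | eq t v =>
    rcases hc with hc | hc
    · obtain ⟨ν, n, hn, hcn⟩ := t.exists_of_mem_names_ren r hc
      exact ⟨ν, n, hn.trans Set.subset_union_left, hcn⟩
    · obtain ⟨ν, n, hn, hcn⟩ := v.exists_of_mem_names_ren r hc
      exact ⟨ν, n, hn.trans Set.subset_union_right, hcn⟩
  | and φ ψ ih₁ ih₂ | or φ ψ ih₁ ih₂ | imp φ ψ ih₁ ih₂ =>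
    rcases hc with hc | hc
    · obtain ⟨ν, n, hn, hcn⟩ := ih₁ r hc
      exact ⟨ν, n, hn.trans Set.subset_union_left, hcn⟩
    · obtain ⟨ν, n, hn, hcn⟩ := ih₂ r hc
      exact ⟨ν, n, hn.trans Set.subset_union_right, hcn⟩
  | ex τ φ ih | all τ φ ih => exact ih r hc
  | new μ φ ih =>
    obtain ⟨ν, n, hn, hcn⟩ := ih (r.lift μ) hc
    match ν, n, hn, hcn with
    | ν, .free a h, hn, hcn =>
      exact ⟨ν, .free a h, hn, by rwa [NMap.lift, NMap.names_weaken] at hcn⟩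
    | _, .bound .zero, _, hcn => exact hcn.elim
    | ν, .bound (.succ i), _, hcn =>
      exact ⟨ν, .bound i, Set.empty_subset _, by rwa [NMap.lift, NMap.names_weaken] at hcn⟩

theorem Formula.onName_mem_names (s : Swapping S) {φ : Formula S Ξ Γ} {c : S.Name}
    (hc : s.onName c ∈ (φ.ren (NMap.swap s)).names) : c ∈ φ.names := by
  obtain ⟨ν, n, hn, hcn⟩ := φ.exists_of_mem_names_ren _ hc
  cases n with
  | free a h =>
    have : s.onName c = s.onName a := hcn
    rw [s.onName_inj] at this
    exact hn this
  | bound i => exact hcn.elim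

/-- Instances of the body of `Иa.φ` at two names that are fresh for it are related by swapping
the two names. -/
theorem Formula.instName_ren_swap_of_notMem {μ : S.NTy} (φ : Formula S (μ :: Ξ) Γ) {a b : S.Name}
    (ha : S.nty a = μ) (hb : S.nty b = μ) (haφ : a ∉ φ.names) (hbφ : b ∉ φ.names) :
    (φ.instName a ha).ren (NMap.swap ⟨a, b, ha.trans hb.symm⟩) = φ.instName b hb := by
  rw [Formula.instName, Formula.instName, Formula.ren_ren]
  refine φ.ren_congr ⟨fun ν i => ?_, fun ν c hc hcφ => ?_⟩
  · cases i with
    | zero => simp [NMap.comp, NMap.inst, NMap.swap, Swapping.onName_fst ⟨a, b, ha.trans hb.symm⟩]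
    | succ i => rfl
  · have h₁ : c ≠ a := fun h => haφ (h ▸ hcφ)
    have h₂ : c ≠ b := fun h => hbφ (h ▸ hcφ)
    simp [NMap.comp, NMap.inst, NMap.swap,
      Swapping.onName_of_ne ⟨a, b, ha.trans hb.symm⟩ h₁ h₂]

theorem Signature.exists_fresh (S : Signature.{u}) (ν : S.NTy) {A : Set S.Name} (hA : A.Finite) :
    ∃ a, S.nty a = ν ∧ a ∉ A :=
  ((S.infinite_names ν).sdiff hA).nonempty

end Names

end RenamingAndSubstitution

/-! ### Equivariance of satisfaction and of provability -/

section Equivariance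

variable {S : Signature.{u}}

theorem NRef.atom_swap (s : Swapping S) {ν : S.NTy} (n : NRef S [] ν) :
    (NMap.swap s ν n).atom = s.onName n.atom := by
  cases n with
  | free a h => rfl
  | bound i => nomatch i

theorem Tm.eval_ren_swap (s : Swapping S) {τ : S.Typ} (t : Ground S τ) :
    (t.ren (NMap.swap s)).eval = t.eval.swap s := by
  induction t with
  | name n => simp [Tm.ren, Tm.eval, GTerm.swap, NRef.atom_swap]
  | var x => nomatch x
  | app f h ts ih => simp [Tm.ren, Tm.eval, GTerm.swap, ih]
  | swap m n t ih =>
    simp only [Tm.ren, Tm.eval, ih, NRef.atom_swap]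
    exact GTerm.swap_conj s ⟨m.atom, n.atom, _⟩ _
  | abs n t ih => simp [Tm.ren, Tm.eval, GTerm.swap, NRef.atom_swap, ih]

theorem Sat.ren_swap {H : Herbrand S} (s : Swapping S) {φ : Formula S [] []} (h : Sat H φ) :
    Sat H (φ.ren (NMap.swap s)) := by
  induction hn : φ.size using Nat.strong_induction_on generalizing φ s with
  | _ n ih =>
  subst hn
  replace ih : ∀ ψ : Formula S [] [], ψ.size < φ.size → ∀ s, Sat H ψ →
      Sat H (ψ.ren (NMap.swap s)) := fun ψ hψ s h => ih _ hψ s h rfl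
  cases φ with
  | top => exact h
  | bot => exact h
  | pred p ts =>
    rw [Sat] at h
    simp only [Formula.ren, Sat, Tm.eval_ren_swap]
    exact H.equivariant s p _ h
  | fresh n t =>
    rw [Sat] at h
    simp only [Formula.ren, Sat, Tm.eval_ren_swap, NRef.atom_swap]
    exact h.swap s
  | eq t v =>
    rw [Sat] at h
    simp only [Formula.ren, Sat, Tm.eval_ren_swap]
    exact h.swap s
  | and φ ψ =>
    rw [Sat] at h
    rw [Formula.ren, Sat]
    exact ⟨ih φ (by simp only [Formula.size]; omega) s h.1,
      ih ψ (by simp only [Formula.size]; omega) s h.2⟩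
  | or φ ψ =>
    rw [Sat] at h
    rw [Formula.ren, Sat]
    exact h.imp (ih φ (by simp only [Formula.size]; omega) s)
      (ih ψ (by simp only [Formula.size]; omega) s)
  | imp φ ψ =>
    rw [Sat] at h
    rw [Formula.ren, Sat]
    intro hφ
    have := ih (φ.ren (NMap.swap s)) (by simp only [Formula.size, Formula.size_ren]; omega) s hφ
    rw [Formula.ren_swap_swap] at this
    exact ih ψ (by simp only [Formula.size]; omega) s (h this)
  | ex τ φ =>
    rw [Sat] at h
    rw [Formula.ren, Sat]
    obtain ⟨t, h⟩ := h
    refine ⟨t.ren (NMap.swap s), ?_⟩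
    rw [← Formula.instVar_ren]
    exact ih _ (by simp only [Formula.size, Formula.instVar, Formula.size_subst]; omega) s h
  | all τ φ =>
    rw [Sat] at h
    rw [Formula.ren, Sat]
    intro t
    have := ih _ (by simp only [Formula.size, Formula.instVar, Formula.size_subst]; omega) s
      (h (t.ren (NMap.swap s)))
    rwa [Formula.instVar_ren, Tm.ren_swap_swap] at this
  | new ν φ =>
    rw [Sat] at h
    rw [Formula.ren, Sat, NMap.lift_swap]
    obtain ⟨b, hb, hbφ, h⟩ := h
    refine ⟨s.onName b, (s.nty_onName b).trans hb,
      fun hm => hbφ (Formula.onName_mem_names s hm), ?_⟩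
    rw [← Formula.instName_ren_swap φ s b hb]
    exact ih _ (by simp only [Formula.size, Formula.instName, Formula.size_ren]; omega) s h

theorem sat_imp_iff {H : Herbrand S} {φ ψ : Formula S [] []} :
    Sat H (.imp φ ψ) ↔ (Sat H φ → Sat H ψ) := by
  rw [Sat]

theorem sat_ren_swap_iff {H : Herbrand S} (s : Swapping S) {φ : Formula S [] []} :
    Sat H (φ.ren (NMap.swap s)) ↔ Sat H φ :=
  ⟨fun h => by simpa using h.ren_swap s, fun h => h.ren_swap s⟩

theorem sat_perm_iff {H : Herbrand S} (π : Permutation S) {φ : Formula S [] []} :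
    Sat H (φ.perm π) ↔ Sat H φ := by
  induction π with
  | nil => rfl
  | cons s π ih => exact (sat_ren_swap_iff s).trans ih

theorem Formula.perm_pred (π : Permutation S) {Ξ : List S.NTy} {Γ : List S.Typ} (p : S.Pr)
    (ts : ∀ i : Fin (S.pdom p).length, Tm S Ξ Γ ((S.pdom p).get i)) :
    (Formula.pred p ts).perm π = .pred p (fun i => (ts i).perm π) := by
  induction π with
  | nil => rfl
  | cons s π ih => exact congrArg (fun φ => Formula.ren (NMap.swap s) φ) ih

/-- The some/any property of `И`: satisfaction at one fresh name gives it at every other. -/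
theorem Sat.instName_of_new {H : Herbrand S} {ν : S.NTy} {φ : Formula S [ν] []}
    (h : Sat H (.new ν φ)) {b : S.Name} (hb : S.nty b = ν) (hbφ : b ∉ φ.names) :
    Sat H (φ.instName b hb) := by
  rw [Sat] at h
  obtain ⟨a, ha, haφ, h⟩ := h
  rw [← φ.instName_ren_swap_of_notMem ha hb haφ hbφ]
  exact h.ren_swap _

theorem Derivable.ren_swap {Δ : Set (Clause S)} (s : Swapping S) {φ : Formula S [] []}
    (h : Derivable Δ φ) : Derivable Δ (φ.ren (NMap.swap s)) := by
  induction h with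
  | top => exact .top
  | fresh n t h =>
    refine .fresh _ _ ?_
    rw [Tm.eval_ren_swap, NRef.atom_swap]
    exact h.swap s
  | eq t v h =>
    refine .eq _ _ ?_
    rw [Tm.eval_ren_swap, Tm.eval_ren_swap]
    exact h.swap s
  | and φ ψ _ _ ih₁ ih₂ => exact .and _ _ ih₁ ih₂
  | or_left φ ψ _ ih => exact .or_left _ _ ih
  | or_right φ ψ _ ih => exact .or_right _ _ ih
  | ex φ t _ ih =>
    refine .ex _ (t.ren (NMap.swap s)) ?_
    rwa [← Formula.instVar_ren]
  | @new ν φ a ha haφ _ ih =>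
    rw [Formula.ren, NMap.lift_swap]
    refine .new _ (s.onName a) ((s.nty_onName a).trans ha)
      (fun hm => haφ (Formula.onName_mem_names s hm)) ?_
    rwa [← Formula.instName_ren_swap]
  | backchain D hD ρ hρ ρ_inj π θ ts hts _ ih =>
    refine .backchain D hD ρ hρ ρ_inj (s :: π) θ _ (fun i => ?_) ih
    rw [Tm.eval_ren_swap]
    refine ((hts i).swap s).trans ?_
    rw [← Tm.eval_ren_swap]
    exact Equal.refl _

/-- Provability of an atom depends only on its arguments up to `≈`. -/
theorem Derivable.pred_congr {Δ : Set (Clause S)} {p : S.Pr}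
    {ts us : ∀ i : Fin (S.pdom p).length, Ground S ((S.pdom p).get i)}
    (h : Derivable Δ (.pred p ts)) (hE : ∀ i, Equal (us i).eval (ts i).eval) :
    Derivable Δ (.pred p us) := by
  cases h with
  | backchain D hD ρ hρ ρ_inj π θ ts hts h =>
    exact .backchain D hD ρ hρ ρ_inj π θ us (fun i => (hE i).trans (hts i)) h

end Equivariance

/-! ### Satisfaction of program clauses -/

section Clauses

variable {S : Signature.{u}}

theorem Formula.names_allAll {Ξ : List S.NTy} (Γ : List S.Typ) (φ : Formula S Ξ Γ) :
    (allAll Γ φ).names = φ.names := by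
  induction Γ with
  | nil => rfl
  | cons τ Γ ih => exact ih _

theorem Formula.ren_allAll {Ξ Ξ' : List S.NTy} (r : NMap S Ξ Ξ') (Γ : List S.Typ)
    (φ : Formula S Ξ Γ) : (allAll Γ φ).ren r = allAll Γ (φ.ren r) := by
  induction Γ with
  | nil => rfl
  | cons τ Γ ih => exact ih _

theorem sat_allAll_iff {H : Herbrand S} {Γ : List S.Typ} (φ : Formula S [] Γ) :
    Sat H (Formula.allAll Γ φ) ↔ ∀ θ : Sub S [] Γ [], Sat H (φ.subst θ) := by
  induction Γ with
  | nil =>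
    have hθ : ∀ θ : Sub S [] [] [], φ.subst θ = φ := fun θ => by
      conv_rhs => rw [← φ.subst_var]
      congr 1
      funext τ x
      nomatch x
    simp only [hθ, Formula.allAll]
    exact ⟨fun h _ => h, fun h => h fun _ x => nomatch x⟩
  | cons τ Γ ih =>
    rw [Formula.allAll, ih]
    simp only [Formula.subst, Sat, Formula.instVar_subst_lift]
    constructor
    · intro h θ
      convert h (fun κ x => θ κ x.succ) (θ _ .zero) using 2
      funext κ x
      cases x <;> rfl
    · exact fun h θ t => h _

/-- A choice of names, of the right types, for the bound names typed by `Ξ`. -/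
structure NameChoice (S : Signature.{u}) (Ξ : List S.NTy) where
  /-- the name chosen for a bound name -/
  toFun : ∀ ν : S.NTy, Idx Ξ ν → S.Name
  nty_toFun : ∀ ν i, S.nty (toFun ν i) = ν

namespace NameChoice

variable {Ξ : List S.NTy}

/-- The choices of pairwise distinct names. -/
def Distinct (ρ : NameChoice S Ξ) : Prop :=
  Function.Injective (fun x : (ν : S.NTy) × Idx Ξ ν => ρ.toFun x.1 x.2)

/-- The replacement of all bound names by the chosen names. -/
def inst (ρ : NameChoice S Ξ) : NMap S Ξ [] :=
  NMap.instAll ρ.toFun ρ.nty_toFun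

/-- The choice of the name `b` for the innermost bound name, in addition to `ρ`. -/
def cons {μ : S.NTy} (ρ : NameChoice S Ξ) (b : S.Name) (hb : S.nty b = μ) :
    NameChoice S (μ :: Ξ) where
  toFun
    | _, .zero => b
    | _, .succ i => ρ.toFun _ i
  nty_toFun
    | _, .zero => hb
    | _, .succ i => ρ.nty_toFun _ i

/-- The chosen names. -/
def names (ρ : NameChoice S Ξ) : Set S.Name :=
  Set.range (fun x : (ν : S.NTy) × Idx Ξ ν => ρ.toFun x.1 x.2)

theorem exists_eq_cons {μ : S.NTy} (ρ : NameChoice S (μ :: Ξ)) :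
    ∃ (ρ' : NameChoice S Ξ) (b : S.Name) (hb : S.nty b = μ), ρ = ρ'.cons b hb := by
  refine ⟨⟨fun ν i => ρ.toFun ν i.succ, fun ν i => ρ.nty_toFun ν i.succ⟩, ρ.toFun μ .zero,
    ρ.nty_toFun μ .zero, ?_⟩
  obtain ⟨f, hf⟩ := ρ
  rw [cons, mk.injEq]
  funext ν i
  cases i <;> rfl

theorem distinct_cons_iff {μ : S.NTy} (ρ : NameChoice S Ξ) (b : S.Name) (hb : S.nty b = μ) :
    (ρ.cons b hb).Distinct ↔ ρ.Distinct ∧ b ∉ ρ.names := by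
  constructor
  · intro h
    refine ⟨?_, ?_⟩
    · rintro ⟨ν, i⟩ ⟨ν', i'⟩ hi
      have := @h ⟨ν, i.succ⟩ ⟨ν', i'.succ⟩ hi
      cases this
      rfl
    · rintro ⟨⟨ν, i⟩, hi⟩
      have := @h ⟨ν, i.succ⟩ ⟨μ, .zero⟩ hi
      cases this
  · rintro ⟨h, hb'⟩ ⟨ν, i⟩ ⟨ν', i'⟩ hi
    cases i with
    | zero =>
      cases i' with
      | zero => rfl
      | succ i' => exact (hb' ⟨⟨_, i'⟩, hi.symm⟩).elim
    | succ i =>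
      cases i' with
      | zero => exact (hb' ⟨⟨_, i⟩, hi⟩).elim
      | succ i' =>
        have := @h ⟨_, i⟩ ⟨_, i'⟩ hi
        cases this
        rfl

theorem names_finite (ρ : NameChoice S Ξ) : ρ.names.Finite := by
  induction Ξ with
  | nil =>
    refine Set.Finite.subset Set.finite_empty ?_
    rintro _ ⟨⟨ν, i⟩, rfl⟩
    nomatch i
  | cons μ Ξ ih =>
    obtain ⟨ρ, b, hb, rfl⟩ := ρ.exists_eq_cons
    refine ((ih ρ).insert b).subset ?_
    rintro _ ⟨⟨ν, i⟩, rfl⟩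
    cases i with
    | zero => exact .inl rfl
    | succ i => exact .inr ⟨⟨_, i⟩, rfl⟩

theorem instName_lift_inst {Γ : List S.Typ} {μ : S.NTy} (ρ : NameChoice S Ξ) (b : S.Name)
    (hb : S.nty b = μ) (φ : Formula S (μ :: Ξ) Γ) :
    (φ.ren (ρ.inst.lift μ)).instName b hb = φ.ren (ρ.cons b hb).inst := by
  rw [Formula.instName, Formula.ren_ren]
  congr 1
  funext ν n
  match ν, n with
  | _, .free a h => rfl
  | _, .bound .zero => rfl
  | _, .bound (.succ i) => rfl

theorem names_ren_lift_inst {Γ : List S.Typ} {μ : S.NTy} (ρ : NameChoice S Ξ)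
    {φ : Formula S (μ :: Ξ) Γ} (hφ : φ.names = ∅) :
    (φ.ren (ρ.inst.lift μ)).names ⊆ ρ.names := by
  intro c hc
  obtain ⟨ν, n, hn, hcn⟩ := φ.exists_of_mem_names_ren _ hc
  match ν, n, hn, hcn with
  | _, .free a h, hn, _ =>
    rw [hφ] at hn
    exact (hn rfl).elim
  | _, .bound .zero, _, hcn => exact hcn.elim
  | _, .bound (.succ i), _, hcn => exact ⟨⟨_, i⟩, Eq.symm hcn⟩

end NameChoice

/-- For a closed matrix, the prefix `Иa₁…aₘ` amounts to quantifying over all choices of pairwise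
distinct names for `a₁,…,aₘ`. -/
theorem sat_newAll_iff {H : Herbrand S} {Ξ : List S.NTy} (φ : Formula S Ξ []) (hφ : φ.names = ∅) :
    Sat H (Formula.newAll Ξ φ) ↔ ∀ ρ : NameChoice S Ξ, ρ.Distinct → Sat H (φ.ren ρ.inst) := by
  induction Ξ with
  | nil =>
    have hρ : ∀ ρ : NameChoice S [], φ.ren ρ.inst = φ := fun ρ => φ.ren_id fun ν n => by
      cases n with
      | free a h => rfl
      | bound i => nomatch i
    simp only [hρ, Formula.newAll]
    refine ⟨fun h _ _ => h, fun h => h ⟨fun _ i => (nomatch i), fun _ i => (nomatch i)⟩ ?_⟩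
    rintro ⟨_, i⟩
    nomatch i
  | cons ν Ξ ih =>
    rw [Formula.newAll, ih _ hφ]
    constructor
    · intro h ρ hρ
      obtain ⟨ρ, b, hb, rfl⟩ := ρ.exists_eq_cons
      rw [NameChoice.distinct_cons_iff] at hρ
      rw [← NameChoice.instName_lift_inst]
      exact (h ρ hρ.1).instName_of_new hb fun hm => hρ.2 (ρ.names_ren_lift_inst hφ hm)
    · intro h ρ hρ
      obtain ⟨b, hb, hb'⟩ := S.exists_fresh ν ρ.names_finite
      rw [Formula.ren, Sat]
      refine ⟨b, hb, fun hm => hb' (ρ.names_ren_lift_inst hφ hm), ?_⟩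
      rw [NameChoice.instName_lift_inst]
      exact h _ ((ρ.distinct_cons_iff b hb).2 ⟨hρ, hb'⟩)

theorem Clause.sat_toFormula_iff {H : Herbrand S} (D : Clause S) :
    Sat H D.toFormula ↔ ∀ ρ : NameChoice S D.Ξ, ρ.Distinct → ∀ θ : Sub S [] D.Γ [],
      Sat H ((D.body.ren ρ.inst).subst θ) →
        Sat H (.pred D.p fun i => ((D.args i).ren ρ.inst).subst θ) := by
  rw [Clause.toFormula, sat_newAll_iff]
  · simp only [Formula.ren_allAll, sat_allAll_iff, Formula.ren, Formula.subst]
    refine forall_congr' fun ρ => imp_congr_right fun _ => forall_congr' fun θ => sat_imp_iff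
  · rw [Formula.names_allAll]
    simp [Formula.names, D.args_closed, D.body_closed]

end Clauses

/-! ### Soundness -/

section Soundness

variable {S : Signature.{u}}

theorem Derivable.sat {Δ : Set (Clause S)} {H : Herbrand S}
    (hH : ∀ D ∈ Δ, Sat H D.toFormula) {φ : Formula S [] []} (h : Derivable Δ φ) : Sat H φ := by
  induction h with
  | top => simp [Sat]
  | fresh n t h => rwa [Sat]
  | eq t v h => rwa [Sat]
  | and φ ψ _ _ ih₁ ih₂ => rw [Sat]; exact ⟨ih₁, ih₂⟩
  | or_left φ ψ _ ih => rw [Sat]; exact .inl ih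
  | or_right φ ψ _ ih => rw [Sat]; exact .inr ih
  | ex φ t _ ih => rw [Sat]; exact ⟨t, ih⟩
  | new φ a ha haφ _ ih => rw [Sat]; exact ⟨a, ha, haφ, ih⟩
  | backchain D hD ρ hρ ρ_inj π θ ts hts _ ih =>
    have h := D.sat_toFormula_iff.1 (hH D hD) ⟨ρ, hρ⟩ ρ_inj θ ((sat_perm_iff π).1 ih)
    rw [← sat_perm_iff π, Formula.perm_pred, Sat] at h
    rw [Sat]
    exact H.respects _ _ _ (fun i => (hts i).symm) h

end Soundness

/-! ### The Herbrand interpretation of the provable atoms -/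

section Completeness

variable {S : Signature.{u}}

/-- A ground nominal term as an expression. -/
def GTerm.toGround : {τ : S.Typ} → GTerm S τ → Ground S τ
  | _, .name a h => .name (.free a h)
  | _, .app f h ts => .app f h (fun i => (ts i).toGround)
  | _, .abs a h t => .abs (.free a h) t.toGround

@[simp] theorem GTerm.eval_toGround {τ : S.Typ} (t : GTerm S τ) : t.toGround.eval = t := by
  induction t with
  | name a h => rfl
  | app f h ts ih => simp [GTerm.toGround, Tm.eval, ih]
  | abs a h t ih => simp [GTerm.toGround, Tm.eval, ih, NRef.atom]

/-- The least Herbrand model of `Δ`: the ground atoms that are provable from `Δ`. -/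
def provableAtoms (Δ : Set (Clause S)) : Herbrand S where
  carrier := {A | Derivable Δ (.pred A.p fun i => (A.args i).toGround)}
  equivariant s p ts h := by
    refine (Derivable.ren_swap s h).pred_congr fun i => ?_
    rw [Tm.eval_ren_swap, GTerm.eval_toGround, GTerm.eval_toGround]
    exact Equal.refl _
  respects p ts us hE h := by
    refine Derivable.pred_congr h fun i => ?_
    rw [GTerm.eval_toGround, GTerm.eval_toGround]
    exact (hE i).symm

theorem sat_provableAtoms_pred_iff {Δ : Set (Clause S)} {p : S.Pr}
    {ts : ∀ i : Fin (S.pdom p).length, Ground S ((S.pdom p).get i)} :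
    Sat (provableAtoms Δ) (.pred p ts) ↔ Derivable Δ (.pred p ts) := by
  rw [Sat]
  constructor
  · intro h
    refine Derivable.pred_congr h fun i => ?_
    rw [GTerm.eval_toGround]
    exact Equal.refl _
  · intro h
    refine Derivable.pred_congr h fun i => ?_
    rw [GTerm.eval_toGround]
    exact Equal.refl _

theorem Formula.IsGoal.ren {Ξ Ξ' : List S.NTy} {Γ : List S.Typ} (r : NMap S Ξ Ξ')
    {φ : Formula S Ξ Γ} (h : φ.IsGoal) : (φ.ren r).IsGoal := by
  induction φ generalizing Ξ' <;> simp_all [Formula.ren, Formula.IsGoal]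

theorem Formula.IsGoal.subst {Ξ : List S.NTy} {Γ Γ' : List S.Typ} (σ : Sub S Ξ Γ Γ')
    {φ : Formula S Ξ Γ} (h : φ.IsGoal) : (φ.subst σ).IsGoal := by
  induction φ generalizing Γ' <;> simp_all [Formula.subst, Formula.IsGoal]

theorem derivable_of_sat_provableAtoms {Δ : Set (Clause S)} {φ : Formula S [] []}
    (hφ : φ.IsGoal) (h : Sat (provableAtoms Δ) φ) : Derivable Δ φ := by
  induction hn : φ.size using Nat.strong_induction_on generalizing φ with
  | _ n ih =>
  subst hn
  replace ih : ∀ ψ : Formula S [] [], ψ.size < φ.size → ψ.IsGoal → Sat (provableAtoms Δ) ψ →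
      Derivable Δ ψ := fun ψ hlt hψ h => ih _ hlt hψ h rfl
  cases φ with
  | top => exact .top
  | bot => exact hφ.elim
  | pred p ts => exact sat_provableAtoms_pred_iff.1 h
  | fresh n t => rw [Sat] at h; exact .fresh n t h
  | eq t v => rw [Sat] at h; exact .eq t v h
  | and φ ψ =>
    rw [Sat] at h
    exact .and _ _ (ih φ (by simp only [Formula.size]; omega) hφ.1 h.1)
      (ih ψ (by simp only [Formula.size]; omega) hφ.2 h.2)
  | or φ ψ =>
    rw [Sat] at h
    rcases h with h | h
    · exact .or_left _ _ (ih φ (by simp only [Formula.size]; omega) hφ.1 h)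
    · exact .or_right _ _ (ih ψ (by simp only [Formula.size]; omega) hφ.2 h)
  | imp φ ψ => exact hφ.elim
  | ex τ φ =>
    rw [Sat] at h
    obtain ⟨t, h⟩ := h
    exact .ex _ t (ih _ (by simp only [Formula.size, Formula.instVar, Formula.size_subst]; omega)
      (Formula.IsGoal.subst _ hφ) h)
  | all τ φ => exact hφ.elim
  | new ν φ =>
    rw [Sat] at h
    obtain ⟨b, hb, hbφ, h⟩ := h
    exact .new _ b hb hbφ
      (ih _ (by simp only [Formula.size, Formula.instName, Formula.size_ren]; omega)
        (Formula.IsGoal.ren _ hφ) h)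

theorem sat_provableAtoms_toFormula {Δ : Set (Clause S)} {D : Clause S} (hD : D ∈ Δ) :
    Sat (provableAtoms Δ) D.toFormula := by
  rw [D.sat_toFormula_iff]
  intro ρ hρ θ h
  rw [sat_provableAtoms_pred_iff]
  -- backchaining on `D` with the identity permutation
  exact .backchain D hD ρ.toFun ρ.nty_toFun hρ [] θ _ (fun i => Equal.refl _)
    (derivable_of_sat_provableAtoms ((D.isGoal.ren _).subst θ) h)

end Completeness

end AlphaProlog

theorem theorem1 (S : AlphaProlog.Signature.{u}) (Δ : Set (AlphaProlog.Clause S))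
    (G : AlphaProlog.Formula S [] []) (hG : G.IsGoal) :
    AlphaProlog.Entails (AlphaProlog.Clause.toFormula '' Δ) G ↔ AlphaProlog.Derivable Δ G := by
  constructor
  · intro h
    refine AlphaProlog.derivable_of_sat_provableAtoms hG (h _ ?_)
    rintro _ ⟨D, hD, rfl⟩
    exact AlphaProlog.sat_provableAtoms_toFormula hD
  · intro h H hH
    exact h.sat fun D hD => hH _ ⟨D, hD, rfl⟩
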